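/- Let $|\Phi^+\rangle=\tfrac{1}{\sqrt2}(|00\rangle+|11\rangle)$. For a two-qubit state $\rho$ (a positive semidefinite operator of trace one on $\mathbb C^2\otimes\mathbb C^2$) let $$F(\rho)=\max_{U_A,U_B}\langle\Phi^+|(U_A\otimes U_B)\,\rho\,(U_A\otimes U_B)^\dagger|\Phi^+\rangle$$ be its fully entangled fraction, where $U_A,U_B$ range over the unitary operators on $\mathbb C^2$. Let $NL[\rho]$ be the maximal value of $$E_{0,0}+E_{0,1}+E_{1,0}-E_{1,1},\qquad E_{x,y}=P(0,0|x,y)+P(1,1|x,y)-P(0,1|x,y)-P(1,0|x,y),$$ over all statistics $P(a,b|x,y)=\mathrm{Tr}\big((P_A^{x,a}\otimes P_B^{y,b})\rho\big)$, $a,b,x,y\in\{0,1\}$, where for each $x$ and each $y$ the pairs $\{P_A^{x,0},P_A^{x,1}\}$ and $\{P_B^{y,0},P_B^{y,1}\}$ are two-outcome projective measurements of a qubit with rank-one projectors (that is, measurements of observables with eigenvalues $+1$ and $-1$). Let $\alpha\in[0,1]$ and let $$\Omega_\alpha=\alpha\,|\Phi^+\rangle\langle\Phi^+|+\tfrac{1-\alpha}{2}|00\rangle\langle00|+\tfrac{1-\alpha}{2}|11\rangle\langle11|$$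 be the weakly entangled mixed state. Let $(\sigma^{ij})$ be a finite doubly indexed family of arbitrary two-qubit states and let $p_{ij}\ge0$ with $\sum_{ij}p_{ij}=1$. If $$F(\Omega_\alpha)\ \ge\ \sum_{ij}p_{ij}\,F(\sigma^{ij}),$$ then $$\sum_{ij}p_{ij}\,NL[\sigma^{ij}]\ \le\ NL[\Omega_\alpha]+c(\alpha),\qquad c(\alpha)=\alpha(2\sqrt2-2)-2\sqrt{1+\alpha^2}+2 .$$ -/

import Mathlib

open scoped Matrix Kronecker ComplexOrder

noncomputable section

namespace TwoQubit

/-- Operators on one qubit, in the computational basis. -/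
abbrev QubitOp : Type := Matrix (Fin 2) (Fin 2) ℂ

/-- Operators on two qubits; the basis vector `|ab⟩` has index `(a, b)`. -/
abbrev Op : Type := Matrix (Fin 2 × Fin 2) (Fin 2 × Fin 2) ℂ

/-- Two-qubit quantum states (density operators). -/
def IsState (ρ : Op) : Prop := ρ.PosSemidef ∧ ρ.trace = 1

/-- The computational basis vector `|ab⟩`. -/
def ket (a b : Fin 2) : Fin 2 × Fin 2 → ℂ := Pi.single (a, b) 1

/-- The operator `|ψ⟩⟨ψ|`. -/
def ketbra (ψ : Fin 2 × Fin 2 → ℂ) : Op := Matrix.vecMulVec ψ (star ψ)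

/-- The maximally entangled state vector `|Φ⁺⟩ = (|00⟩ + |11⟩) / √2`. -/
def phiPlus : Fin 2 × Fin 2 → ℂ := ((1 / Real.sqrt 2 : ℝ) : ℂ) • (ket 0 0 + ket 1 1)

/-- The weakly entangled mixed state `Ω_α`. -/
def weaklyEntangled (α : ℝ) : Op :=
  (α : ℂ) • ketbra phiPlus + (((1 - α) / 2 : ℝ) : ℂ) • ketbra (ket 0 0)
    + (((1 - α) / 2 : ℝ) : ℂ) • ketbra (ket 1 1)

/-- `⟨Φ⁺| (U ⊗ V) ρ (U ⊗ V)† |Φ⁺⟩`, which is a real number for Hermitian `ρ`. -/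
def overlap (ρ : Op) (U V : Matrix.unitaryGroup (Fin 2) ℂ) : ℝ :=
  (star phiPlus ⬝ᵥ
    (((U : QubitOp) ⊗ₖ (V : QubitOp)) * ρ * ((U : QubitOp) ⊗ₖ (V : QubitOp))ᴴ) *ᵥ phiPlus).re

/-- The fully entangled fraction `F(ρ)`. -/
def fullyEntangledFraction (ρ : Op) : ℝ :=
  ⨆ UV : Matrix.unitaryGroup (Fin 2) ℂ × Matrix.unitaryGroup (Fin 2) ℂ, overlap ρ UV.1 UV.2

/-- A projective measurement of one qubit with two outcomes `0, 1`, each given by a projector of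
rank one; equivalently, a measurement of the observable `proj 0 - proj 1`, whose
eigenvalues are `+1` and `-1`. -/
structure QubitMeasurement where
  proj : Fin 2 → QubitOp
  isHermitian : ∀ a, (proj a).IsHermitian
  idempotent : ∀ a, proj a * proj a = proj a
  rank_eq_one : ∀ a, (proj a).rank = 1
  sum_eq_one : proj 0 + proj 1 = 1

/-- The input/output behaviour of a bipartite system with binary inputs and outputs:
`P a b x y` stands for `P(a, b | x, y)`. -/
abbrev Behaviour : Type := Fin 2 → Fin 2 → Fin 2 → Fin 2 → ℝ

/-- The correlation function `E_{x,y}`. -/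
def corr (P : Behaviour) (x y : Fin 2) : ℝ :=
  P 0 0 x y + P 1 1 x y - P 0 1 x y - P 1 0 x y

/-- The CHSH-type non-locality of a behaviour. -/
def chsh (P : Behaviour) : ℝ := corr P 0 0 + corr P 0 1 + corr P 1 0 - corr P 1 1

/-- The statistics obtained when on input `x` Alice measures `A x` on the first qubit of `ρ`, and
on input `y` Bob measures `B y` on the second: `P(a, b | x, y) = Tr ((A^{x,a} ⊗ B^{y,b}) ρ)`,
a real number for Hermitian `ρ`. -/
def behaviour (ρ : Op) (A B : Fin 2 → QubitMeasurement) : Behaviour :=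
  fun a b x y => ((((A x).proj a) ⊗ₖ ((B y).proj b)) * ρ).trace.re

/-- The non-locality `NL[ρ]` of a two-qubit state: the maximal CHSH-type non-locality
attainable by measurements on `ρ`. -/
def nonlocality (ρ : Op) : ℝ :=
  ⨆ AB : (Fin 2 → QubitMeasurement) × (Fin 2 → QubitMeasurement), chsh (behaviour ρ AB.1 AB.2)

/-- `c(α) = α (2√2 - 2) - 2√(1 + α²) + 2`. -/
def gap (α : ℝ) : ℝ := α * (2 * Real.sqrt 2 - 2) - 2 * Real.sqrt (1 + α ^ 2) + 2

end TwoQubit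

end

namespace TwoQubit

open Matrix

/-! Everything rests on an affine bound valid for every state, `nonlocality_le`: NL ≤ (4 - 2√2) +
(4√2 - 4) F, the line through (F, NL) = (1/2, 2) and (1, 2√2). Being affine, it survives averaging
over the ensemble, so it remains to bound F(Ω_α) above by (1 + α)/2 and NL[Ω_α] below by 2√(1 + α²);
what is left over is exactly `gap α`.

For the affine bound, local unitaries turn all four observables into real planar ones. The CHSH
operator then has an eigenbasis of four real maximally entangled vectors with eigenvalues a, -a, b,
-b, where a² + b² = 8 (`chsh_planar_eq`). Dropping the negative part leaves a f + b g, where the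
overlaps f, g are at most F and f + g ≤ 1; `weighted_le_of_sq_add_sq` finishes. -/

/-! ### Overlaps with maximally entangled vectors. -/

theorem overlap_conj (ρ : Op) (U V U' V' : Matrix.unitaryGroup (Fin 2) ℂ) :
    overlap (((U : QubitOp) ⊗ₖ (V : QubitOp))ᴴ * ρ * ((U : QubitOp) ⊗ₖ (V : QubitOp))) U' V'
      = overlap ρ (U' * U⁻¹) (V' * V⁻¹) := by
  have h : (((U' * U⁻¹ : Matrix.unitaryGroup (Fin 2) ℂ) : QubitOp)
      ⊗ₖ ((V' * V⁻¹ : Matrix.unitaryGroup (Fin 2) ℂ) : QubitOp))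
      = ((U' : QubitOp) ⊗ₖ (V' : QubitOp)) * ((U : QubitOp) ⊗ₖ (V : QubitOp))ᴴ := by
    rw [conjTranspose_kronecker, ← mul_kronecker_mul]
    rfl
  unfold overlap
  rw [h]
  simp only [conjTranspose_mul, conjTranspose_conjTranspose, Matrix.mul_assoc]

theorem kronecker_conjTranspose_mul_self (U V : Matrix.unitaryGroup (Fin 2) ℂ) :
    ((U : QubitOp) ⊗ₖ (V : QubitOp))ᴴ * ((U : QubitOp) ⊗ₖ (V : QubitOp)) = 1 := by
  rw [conjTranspose_kronecker, ← mul_kronecker_mul]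
  have hU : (U : QubitOp)ᴴ * U = 1 := Matrix.mem_unitaryGroup_iff'.1 U.2
  have hV : (V : QubitOp)ᴴ * V = 1 := Matrix.mem_unitaryGroup_iff'.1 V.2
  rw [hU, hV, one_kronecker_one]

theorem kronecker_mul_conjTranspose_self (U V : Matrix.unitaryGroup (Fin 2) ℂ) :
    ((U : QubitOp) ⊗ₖ (V : QubitOp)) * ((U : QubitOp) ⊗ₖ (V : QubitOp))ᴴ = 1 :=
  mul_eq_one_comm.1 (kronecker_conjTranspose_mul_self U V)

theorem overlap_nonneg {ρ : Op} (hρ : ρ.PosSemidef) (U V : Matrix.unitaryGroup (Fin 2) ℂ) :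
    0 ≤ overlap ρ U V :=
  (hρ.mul_mul_conjTranspose_same ((U : QubitOp) ⊗ₖ (V : QubitOp))).re_dotProduct_nonneg phiPlus

theorem overlap_add (ρ τ : Op) (U V : Matrix.unitaryGroup (Fin 2) ℂ) :
    overlap (ρ + τ) U V = overlap ρ U V + overlap τ U V := by
  simp [overlap, Matrix.mul_add, Matrix.add_mul, Matrix.add_mulVec]

theorem overlap_smul (r : ℝ) (ρ : Op) (U V : Matrix.unitaryGroup (Fin 2) ℂ) :
    overlap ((r : ℂ) • ρ) U V = r * overlap ρ U V := by
  simp [overlap, Matrix.smul_mulVec]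

theorem phiPlus_apply (i j : Fin 2) :
    phiPlus (i, j) = if i = j then ((1 / Real.sqrt 2 : ℝ) : ℂ) else 0 := by
  fin_cases i <;> fin_cases j <;> simp [phiPlus, ket]

theorem inv_sqrt_two_mul_self : (1 / Real.sqrt 2) * (1 / Real.sqrt 2) = 1 / 2 := by
  rw [div_mul_div_comm, Real.mul_self_sqrt zero_le_two, one_mul]

theorem ofReal_inv_sqrt_two_mul_self : ((√2 : ℝ) : ℂ)⁻¹ * ((√2 : ℝ) : ℂ)⁻¹ = 1 / 2 := by
  have := congrArg Complex.ofReal inv_sqrt_two_mul_self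
  push_cast at this
  simpa using this

theorem ket_apply (a b c d : Fin 2) : ket a b (c, d) = if c = a ∧ d = b then 1 else 0 := by
  simp [ket, Pi.single_apply]

theorem phiPlus_expectation (M : Op) :
    (star phiPlus ⬝ᵥ M *ᵥ phiPlus).re
      = ((M (0, 0) (0, 0)).re + (M (0, 0) (1, 1)).re + (M (1, 1) (0, 0)).re
        + (M (1, 1) (1, 1)).re) / 2 := by
  have h := inv_sqrt_two_mul_self
  simp only [dotProduct, mulVec, Fintype.sum_prod_type, Fin.sum_univ_two, Pi.star_apply,
    phiPlus_apply]
  simp only [Fin.isValue, Complex.star_def, reduceIte, zero_ne_one, one_ne_zero, Complex.conj_ofReal, map_zero, mul_zero, zero_mul, add_zero, zero_add, Complex.add_re, Complex.re_ofReal_mul, Complex.re_mul_ofReal]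
  linear_combination ((M (0, 0) (0, 0)).re + (M (0, 0) (1, 1)).re + (M (1, 1) (0, 0)).re
        + (M (1, 1) (1, 1)).re) * h

theorem overlap_one (U V : Matrix.unitaryGroup (Fin 2) ℂ) : overlap 1 U V = 1 := by
  unfold overlap
  rw [Matrix.mul_one, kronecker_mul_conjTranspose_self, phiPlus_expectation]
  simp

/-! ### Real maximally entangled vectors and planar observables. -/

/-- A real orthogonal matrix, viewed as a unitary one. -/
noncomputable def rot (c s : ℝ) (h : c ^ 2 + s ^ 2 = 1) : Matrix.unitaryGroup (Fin 2) ℂ :=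
  ⟨!![(c : ℂ), -s; s, c], by
    have h' : (c : ℂ) ^ 2 + (s : ℂ) ^ 2 = 1 := by exact_mod_cast h
    rw [Matrix.mem_unitaryGroup_iff]
    ext i j
    fin_cases i <;> fin_cases j <;> simp [Matrix.mul_apply, Fin.sum_univ_two] <;>
      first | ring1 | linear_combination h'⟩

/-- A real reflection of the plane, viewed as a unitary matrix. -/
noncomputable def refl (c s : ℝ) (h : c ^ 2 + s ^ 2 = 1) : Matrix.unitaryGroup (Fin 2) ℂ :=
  ⟨!![(c : ℂ), s; s, -c], by
    have h' : (c : ℂ) ^ 2 + (s : ℂ) ^ 2 = 1 := by exact_mod_cast h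
    rw [Matrix.mem_unitaryGroup_iff]
    ext i j
    fin_cases i <;> fin_cases j <;> simp [Matrix.mul_apply, Fin.sum_univ_two] <;>
      first | ring1 | linear_combination h'⟩

/-- The real part of the quadratic form of `M` at the vector `(w₀₀, w₀₁, w₁₀, w₁₁) / √2`. -/
noncomputable def realForm (M : Op) (W : Fin 2 → Fin 2 → ℝ) : ℝ :=
  (∑ i, ∑ j, ∑ k, ∑ l, W i j * W k l * (M (i, j) (k, l)).re) / 2

/-- (U† ⊗ 1)|Φ⁺⟩ has coefficients conj(U j i)/√2 at (i, j), hence the transpose in `hU`. -/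
theorem overlap_of_real (M : Op) (U : Matrix.unitaryGroup (Fin 2) ℂ) (W : Fin 2 → Fin 2 → ℝ)
    (hU : ∀ i j, (U : QubitOp) j i = W i j) : overlap M U 1 = realForm M W := by
  unfold overlap realForm
  rw [phiPlus_expectation]
  simp [Matrix.mul_apply, Fintype.sum_prod_type, Fin.sum_univ_two, kroneckerMap_apply,
    Matrix.one_apply, hU]
  ring

theorem overlap_rot (M : Op) (c s : ℝ) (h : c ^ 2 + s ^ 2 = 1) :
    overlap M (rot c s h) 1 = realForm M ![![c, s], ![-s, c]] :=
  overlap_of_real M _ _ fun i j => by fin_cases i <;> fin_cases j <;> simp [rot]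

theorem overlap_refl (M : Op) (c s : ℝ) (h : c ^ 2 + s ^ 2 = 1) :
    overlap M (refl c s h) 1 = realForm M ![![c, s], ![s, -c]] :=
  overlap_of_real M _ _ fun i j => by fin_cases i <;> fin_cases j <;> simp [refl]

/-- The planar observable `z σ_z + x σ_x`. -/
noncomputable def planar (z x : ℝ) : QubitOp := !![(z : ℂ), x; x, -z]

theorem trace_planar_kronecker (M : Op) (z x z' x' : ℝ) :
    ((planar z x ⊗ₖ planar z' x') * M).trace.re
      = z * z' * ((M (0, 0) (0, 0)).re - (M (0, 1) (0, 1)).re - (M (1, 0) (1, 0)).re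
          + (M (1, 1) (1, 1)).re)
        + x * x' * ((M (0, 0) (1, 1)).re + (M (1, 1) (0, 0)).re + (M (0, 1) (1, 0)).re
          + (M (1, 0) (0, 1)).re)
        + z * x' * ((M (0, 0) (0, 1)).re + (M (0, 1) (0, 0)).re - (M (1, 0) (1, 1)).re
          - (M (1, 1) (1, 0)).re)
        + x * z' * ((M (0, 0) (1, 0)).re + (M (1, 0) (0, 0)).re - (M (0, 1) (1, 1)).re
          - (M (1, 1) (0, 1)).re) := by
  simp [Matrix.trace, Matrix.mul_apply, Fintype.sum_prod_type, Fin.sum_univ_two,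
    kroneckerMap_apply, planar]
  ring

/-- The four vectors form an orthonormal basis: two rotations a quarter turn apart, and two
reflections likewise, each divided by √2. -/
theorem overlap_sum_eq_trace (M : Op) (c s c' s' : ℝ) (h : c ^ 2 + s ^ 2 = 1)
    (h' : c' ^ 2 + s' ^ 2 = 1) :
    realForm M ![![c, s], ![-s, c]] + realForm M ![![-s, c], ![-c, -s]]
      + (realForm M ![![c', s'], ![s', -c']] + realForm M ![![s', -c'], ![-c', -s']])
      = M.trace.re := by
  simp [realForm, Matrix.trace, Fintype.sum_prod_type, Fin.sum_univ_two]
  linear_combination ((M (0, 0) (0, 0)).re + (M (1, 1) (1, 1)).re + (M (0, 0) (1, 1)).re + (M (1, 1) (0, 0)).re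
      + (M (0, 1) (0, 1)).re + (M (1, 0) (1, 0)).re - (M (0, 1) (1, 0)).re - (M (1, 0) (0, 1)).re) / 2 * h
    + ((M (0, 0) (0, 0)).re + (M (1, 1) (1, 1)).re - (M (0, 0) (1, 1)).re - (M (1, 1) (0, 0)).re
      + (M (0, 1) (0, 1)).re + (M (1, 0) (1, 0)).re + (M (0, 1) (1, 0)).re + (M (1, 0) (0, 1)).re) / 2 * h'

/-- Polar form with the argument halved: a quadratic form in (c, s) depends on the doubled angle. -/
theorem exists_half_angle (u v : ℝ) : ∃ r c s : ℝ, 0 ≤ r ∧ r ^ 2 = u ^ 2 + v ^ 2 ∧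
    c ^ 2 + s ^ 2 = 1 ∧ u = r * (c ^ 2 - s ^ 2) ∧ v = r * (2 * c * s) := by
  set w : ℂ := ⟨u, v⟩ with hw
  have h1 := Complex.norm_mul_cos_arg w
  have h2 := Complex.norm_mul_sin_arg w
  have e : w.arg = 2 * (w.arg / 2) := by ring
  refine ⟨‖w‖, Real.cos (w.arg / 2), Real.sin (w.arg / 2), norm_nonneg w, ?_,
    Real.cos_sq_add_sin_sq _, ?_, ?_⟩
  · rw [Complex.sq_norm, Complex.normSq_apply, hw]; ring
  · rw [← Real.cos_two_mul', ← e, h1]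
  · rw [mul_right_comm, ← Real.sin_two_mul, ← e, h2]

theorem overlap_le_one {ρ : Op} (hρ : IsState ρ) (U V : Matrix.unitaryGroup (Fin 2) ℂ) :
    overlap ρ U V ≤ 1 := by
  set K : Op := ((U⁻¹ : Matrix.unitaryGroup (Fin 2) ℂ) : QubitOp) ⊗ₖ
    ((V⁻¹ : Matrix.unitaryGroup (Fin 2) ℂ) : QubitOp) with hK
  have hM : (Kᴴ * ρ * K).PosSemidef := hρ.1.conjTranspose_mul_mul_same K
  have ht : (Kᴴ * ρ * K).trace = 1 := by
    rw [Matrix.mul_assoc, trace_mul_comm, Matrix.mul_assoc, hK, kronecker_mul_conjTranspose_self,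
      Matrix.mul_one, hρ.2]
  have h0 : (1 : ℝ) ^ 2 + 0 ^ 2 = 1 := by norm_num
  have h1 : (-0 : ℝ) ^ 2 + 1 ^ 2 = 1 := by norm_num
  have h2 : (0 : ℝ) ^ 2 + (-1) ^ 2 = 1 := by norm_num
  have hr : rot 1 0 h0 = 1 := by
    ext i j; fin_cases i <;> fin_cases j <;> simp [rot]
  -- After conjugation the overlap is one of the four terms of a basis expansion of the trace; the
  -- other three are nonnegative.
  have e : overlap ρ U V = overlap (Kᴴ * ρ * K) (rot 1 0 h0) 1 := by
    rw [hK, overlap_conj, hr]; simp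
  have hsum := overlap_sum_eq_trace (Kᴴ * ρ * K) 1 0 1 0 h0 h0
  rw [← overlap_rot _ _ _ h0, ← overlap_rot _ _ _ h1, ← overlap_refl _ _ _ h0,
    ← overlap_refl _ _ _ h2, ht] at hsum
  have a := overlap_nonneg hM (rot _ _ h1) 1
  have b := overlap_nonneg hM (refl _ _ h0) 1
  have c := overlap_nonneg hM (refl _ _ h2) 1
  rw [e]
  simp only [Complex.one_re] at hsum
  linarith

theorem overlap_le_fullyEntangledFraction {ρ : Op} (hρ : IsState ρ)
    (U V : Matrix.unitaryGroup (Fin 2) ℂ) : overlap ρ U V ≤ fullyEntangledFraction ρ :=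
  le_ciSup (f := fun UV : Matrix.unitaryGroup (Fin 2) ℂ × Matrix.unitaryGroup (Fin 2) ℂ =>
    overlap ρ UV.1 UV.2) ⟨1, by rintro _ ⟨UV, rfl⟩; exact overlap_le_one hρ _ _⟩ (U, V)

/-! ### Reduction of measurements to planar observables. -/

/-- Qubit observables with eigenvalues `+1` and `-1`. -/
structure IsDichotomic (A : QubitOp) : Prop where
  isHermitian : A.IsHermitian
  mul_self : A * A = 1
  trace_eq_zero : A.trace = 0

theorem IsDichotomic.conj {A : QubitOp} (hA : IsDichotomic A)
    (U : Matrix.unitaryGroup (Fin 2) ℂ) :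
    IsDichotomic ((U : QubitOp)ᴴ * A * (U : QubitOp)) := by
  have hU : (U : QubitOp) * (U : QubitOp)ᴴ = 1 := Matrix.mem_unitaryGroup_iff.1 U.2
  have hU' : (U : QubitOp)ᴴ * (U : QubitOp) = 1 := Matrix.mem_unitaryGroup_iff'.1 U.2
  refine ⟨isHermitian_conjTranspose_mul_mul _ hA.isHermitian, ?_, ?_⟩
  · calc (U : QubitOp)ᴴ * A * (U : QubitOp) * ((U : QubitOp)ᴴ * A * (U : QubitOp))
        = (U : QubitOp)ᴴ * A * ((U : QubitOp) * (U : QubitOp)ᴴ) * A * (U : QubitOp) := by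
          simp only [Matrix.mul_assoc]
      _ = (U : QubitOp)ᴴ * (A * A) * (U : QubitOp) := by
          rw [hU, Matrix.mul_one, Matrix.mul_assoc (U : QubitOp)ᴴ]
      _ = 1 := by rw [hA.mul_self, Matrix.mul_one, hU']
  · rw [Matrix.mul_assoc, trace_mul_comm, Matrix.mul_assoc, hU, Matrix.mul_one, hA.trace_eq_zero]

theorem IsDichotomic.eq_planar {A : QubitOp} (hA : IsDichotomic A) (h01 : (A 0 1).im = 0) :
    A = planar (A 0 0).re (A 0 1).re ∧ (A 0 0).re ^ 2 + (A 0 1).re ^ 2 = 1 := by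
  have h00 : (A 0 0).im = 0 := Complex.conj_eq_iff_im.1 (hA.isHermitian.apply 0 0)
  have h10 : A 1 0 = star (A 0 1) := (hA.isHermitian.apply 1 0).symm
  have htr : A 0 0 + A 1 1 = 0 := by simpa [Matrix.trace_fin_two] using hA.trace_eq_zero
  have e00 : A 0 0 = ((A 0 0).re : ℂ) := Complex.ext rfl (by simpa using h00)
  have e01 : A 0 1 = ((A 0 1).re : ℂ) := Complex.ext rfl (by simpa using h01)
  have e10 : A 1 0 = ((A 0 1).re : ℂ) := by
    rw [h10, e01]; simp
  have e11 : A 1 1 = -((A 0 0).re : ℂ) := by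
    rw [← e00]; linear_combination htr
  refine ⟨?_, ?_⟩
  · ext i j
    fin_cases i <;> fin_cases j
    · exact e00
    · exact e01
    · exact e10
    · exact e11
  · have h := congrFun (congrFun hA.mul_self 0) 0
    rw [Matrix.mul_apply, Fin.sum_univ_two, e10, e00, e01] at h
    have h' := congrArg Complex.re h
    simp at h'
    linarith

/-- The diagonal unitary `diag(1, e^{-iθ})`. -/
noncomputable def phase (θ : ℝ) : Matrix.unitaryGroup (Fin 2) ℂ :=
  ⟨!![1, 0; 0, Complex.exp (-θ * Complex.I)], by
    rw [Matrix.mem_unitaryGroup_iff]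
    ext i j
    fin_cases i <;> fin_cases j <;>
      simp [Matrix.mul_apply, Fin.sum_univ_two, ← Complex.exp_conj, ← Complex.exp_add]⟩

/-- Diagonalise `A 0`, then use a diagonal phase, which leaves it diagonal, to make the off-diagonal
entry of `A 1` real. -/
theorem exists_conj_planar {A : Fin 2 → QubitOp} (hA : ∀ i, IsDichotomic (A i)) :
    ∃ (U : Matrix.unitaryGroup (Fin 2) ℂ) (z x : Fin 2 → ℝ), (∀ i, z i ^ 2 + x i ^ 2 = 1) ∧
      ∀ i, A i = (U : QubitOp) * planar (z i) (x i) * (U : QubitOp)ᴴ := by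
  set V := (hA 0).isHermitian.eigenvectorUnitary
  have hD : (V : QubitOp)ᴴ * A 0 * (V : QubitOp)
      = diagonal (RCLike.ofReal ∘ (hA 0).isHermitian.eigenvalues) := by
    rw [← (hA 0).isHermitian.conjStarAlgAut_star_eigenvectorUnitary,
      Unitary.conjStarAlgAut_star_apply]
    rfl
  set w := ((V : QubitOp)ᴴ * A 1 * (V : QubitOp)) 0 1
  set U := V * phase w.arg with hU
  have hconj : ∀ i, ((U : QubitOp)ᴴ * A i * (U : QubitOp)) 0 1
      = ((V : QubitOp)ᴴ * A i * (V : QubitOp)) 0 1 * Complex.exp (-w.arg * Complex.I) := by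
    intro i
    have : (U : QubitOp)ᴴ * A i * (U : QubitOp)
        = (phase w.arg : QubitOp)ᴴ * ((V : QubitOp)ᴴ * A i * (V : QubitOp))
          * (phase w.arg : QubitOp) := by
      simp [hU, Matrix.mul_assoc]
    rw [this]
    generalize (V : QubitOp)ᴴ * A i * (V : QubitOp) = B
    rw [Matrix.mul_apply, Fin.sum_univ_two, Matrix.mul_apply, Fin.sum_univ_two]
    simp [phase, Matrix.mul_apply]
  have him : ∀ i, (((U : QubitOp)ᴴ * A i * (U : QubitOp)) 0 1).im = 0 := by
    intro i
    rw [hconj]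
    fin_cases i
    · simp [hD]
    · change (w * Complex.exp (-w.arg * Complex.I)).im = 0
      nth_rewrite 1 [← Complex.norm_mul_exp_arg_mul_I w]
      rw [mul_assoc, ← Complex.exp_add]
      simp
  have hUU : (U : QubitOp) * (U : QubitOp)ᴴ = 1 := Matrix.mem_unitaryGroup_iff.1 U.2
  refine ⟨U, _, _, fun i => (((hA i).conj U).eq_planar (him i)).2, fun i => ?_⟩
  rw [← (((hA i).conj U).eq_planar (him i)).1]
  calc A i = ((U : QubitOp) * (U : QubitOp)ᴴ) * A i * ((U : QubitOp) * (U : QubitOp)ᴴ) := by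
        rw [hUU, Matrix.one_mul, Matrix.mul_one]
    _ = _ := by simp only [Matrix.mul_assoc]

/-- The observable with value `(-1)^a` on outcome `a`. -/
def QubitMeasurement.observable (m : QubitMeasurement) : QubitOp := m.proj 0 - m.proj 1

theorem QubitMeasurement.det_proj (m : QubitMeasurement) (a : Fin 2) : (m.proj a).det = 0 := by
  by_contra h
  have := rank_of_isUnit (m.proj a) ((isUnit_iff_isUnit_det _).2 (isUnit_iff_ne_zero.2 h))
  rw [m.rank_eq_one] at this
  simp at this

theorem QubitMeasurement.isDichotomic_observable (m : QubitMeasurement) :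
    IsDichotomic m.observable := by
  have h1 : m.proj 1 = 1 - m.proj 0 := eq_sub_of_add_eq' m.sum_eq_one
  have d0 := m.det_proj 0
  have d1 := m.det_proj 1
  refine ⟨(m.isHermitian 0).sub (m.isHermitian 1), ?_, ?_⟩
  · have := m.idempotent 0
    simp only [QubitMeasurement.observable, h1, sub_mul, mul_sub, this, Matrix.mul_one,
      Matrix.one_mul]
    abel
  · rw [QubitMeasurement.observable, h1]
    rw [h1] at d1
    rw [det_fin_two] at d0 d1
    simp at d1
    rw [trace_fin_two]
    simp
    -- For 2 × 2 matrices det(1 - P) = 1 - tr P + det P, so both projectors being singular forces tr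
    -- P = 1.
    linear_combination 2 * (d0 - d1)

theorem corr_behaviour (ρ : Op) (A B : Fin 2 → QubitMeasurement) (x y : Fin 2) :
    corr (behaviour ρ A B) x y = (((A x).observable ⊗ₖ (B y).observable) * ρ).trace.re := by
  have h : (A x).observable ⊗ₖ (B y).observable
      = (A x).proj 0 ⊗ₖ (B y).proj 0 + (A x).proj 1 ⊗ₖ (B y).proj 1
        - (A x).proj 0 ⊗ₖ (B y).proj 1 - (A x).proj 1 ⊗ₖ (B y).proj 0 := by
    ext
    simp only [QubitMeasurement.observable, kroneckerMap_apply, Matrix.sub_apply, Matrix.add_apply]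
    ring
  simp [h, corr, behaviour, Matrix.sub_mul, Matrix.add_mul]

theorem trace_conj_kronecker (ρ : Op) (U V : Matrix.unitaryGroup (Fin 2) ℂ) (a b : QubitOp) :
    (((U : QubitOp) * a * (U : QubitOp)ᴴ) ⊗ₖ ((V : QubitOp) * b * (V : QubitOp)ᴴ) * ρ).trace
      = ((a ⊗ₖ b) * (((U : QubitOp) ⊗ₖ (V : QubitOp))ᴴ * ρ *
          ((U : QubitOp) ⊗ₖ (V : QubitOp)))).trace := by
  rw [mul_kronecker_mul, mul_kronecker_mul, ← conjTranspose_kronecker,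
    Matrix.mul_assoc, Matrix.mul_assoc, trace_mul_comm]
  simp only [Matrix.mul_assoc]

/-! ### The bound of non-locality by the fully entangled fraction. -/

/-- Split off K(f + g) ≤ K. The rest is at most (a + b - 2K)F if both weights exceed K, and (2√2 -
K)F if only one does; K = 4 - 2√2 equalises 4 - 2K and 2√2 - K. -/
theorem weighted_le_of_sq_add_sq {a b f g F : ℝ} (ha : 0 ≤ a) (hb : 0 ≤ b)
    (hab : a ^ 2 + b ^ 2 = 8) (hf : 0 ≤ f) (hg : 0 ≤ g) (hfg : f + g ≤ 1) (hfF : f ≤ F)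
    (hgF : g ≤ F) : a * f + b * g ≤ (4 - 2 * √2) + (4 * √2 - 4) * F := by
  have hs : √2 ^ 2 = 2 := Real.sq_sqrt zero_le_two
  have hs0 : 0 ≤ √2 := Real.sqrt_nonneg 2
  have hs1 : 1 ≤ √2 := by nlinarith
  have hs2 : √2 ≤ 2 := by nlinarith
  have h4 : a + b ≤ 4 := by nlinarith [sq_nonneg (a - b)]
  have ha2 : a ≤ 2 * √2 := by nlinarith
  have hb2 : b ≤ 2 * √2 := by nlinarith
  set K := 4 - 2 * √2 with hK
  have hF : 0 ≤ F := hf.trans hfF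
  have key : (a - K) * f + (b - K) * g ≤ (4 * √2 - 4) * F := by
    rcases le_total K a with h | h <;> rcases le_total K b with h' | h'
    · nlinarith [mul_le_mul_of_nonneg_left hfF (sub_nonneg.2 h),
        mul_le_mul_of_nonneg_left hgF (sub_nonneg.2 h'), mul_le_mul_of_nonneg_right h4 hF]
    · nlinarith [mul_le_mul_of_nonneg_left hfF (sub_nonneg.2 h),
        mul_nonneg (sub_nonneg.2 h') hg, mul_le_mul_of_nonneg_right ha2 hF]
    · nlinarith [mul_nonneg (sub_nonneg.2 h) hf,
        mul_le_mul_of_nonneg_left hgF (sub_nonneg.2 h'), mul_le_mul_of_nonneg_right hb2 hF]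
    · nlinarith [mul_nonneg (sub_nonneg.2 h) hf, mul_nonneg (sub_nonneg.2 h') hg,
        mul_nonneg (sub_nonneg.2 hs1) hF]
  nlinarith [mul_nonneg (show 0 ≤ K by linarith) (sub_nonneg.2 hfg)]

/-- The CHSH value of planar observables, as a combination of overlaps with two maximally entangled
vectors and two orthogonal companions. -/
theorem chsh_planar_eq (M : Op) (z x z' x' : Fin 2 → ℝ) (hA : ∀ i, z i ^ 2 + x i ^ 2 = 1)
    (hB : ∀ i, z' i ^ 2 + x' i ^ 2 = 1) (T : Fin 2 → Fin 2 → ℝ)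
    (hT : ∀ i j, T i j = ((planar (z i) (x i) ⊗ₖ planar (z' j) (x' j)) * M).trace.re) :
    ∃ a b c s c' s' : ℝ, 0 ≤ a ∧ 0 ≤ b ∧ a ^ 2 + b ^ 2 = 8 ∧ c ^ 2 + s ^ 2 = 1 ∧
      c' ^ 2 + s' ^ 2 = 1 ∧
      T 0 0 + T 0 1 + T 1 0 - T 1 1 =
        a * (realForm M ![![c, s], ![-s, c]] - realForm M ![![-s, c], ![-c, -s]])
        + b * (realForm M ![![c', s'], ![s', -c']] - realForm M ![![s', -c'], ![-c', -s']]) := by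
  -- The m's are the coefficients of the CHSH operator in products of σ_z and σ_x. Rotations see
  -- only mzz + mxx and mzx - mxz, reflections only mzz - mxx and mzx + mxz.
  obtain ⟨mzz, hzz⟩ : ∃ m, m = z 0 * (z' 0 + z' 1) + z 1 * (z' 0 - z' 1) := ⟨_, rfl⟩
  obtain ⟨mxx, hxx⟩ : ∃ m, m = x 0 * (x' 0 + x' 1) + x 1 * (x' 0 - x' 1) := ⟨_, rfl⟩
  obtain ⟨mzx, hzx⟩ : ∃ m, m = z 0 * (x' 0 + x' 1) + z 1 * (x' 0 - x' 1) := ⟨_, rfl⟩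
  obtain ⟨mxz, hxz⟩ : ∃ m, m = x 0 * (z' 0 + z' 1) + x 1 * (z' 0 - z' 1) := ⟨_, rfl⟩
  obtain ⟨a, c, s, ha, ha2, h, hu, hv⟩ := exists_half_angle (mzz + mxx) (mzx - mxz)
  obtain ⟨b, c', s', hb, hb2, h', hu', hv'⟩ := exists_half_angle (mzz - mxx) (mzx + mxz)
  refine ⟨a, b, c, s, c', s', ha, hb, ?_, h, h', ?_⟩
  -- a² + b² is twice the squared Frobenius norm of m. Sum and difference of Bob's unit vectors are
  -- orthogonal, so that norm squared is |b₀ + b₁|² + |b₀ - b₁|² = 4.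
  · rw [ha2, hb2, hzz, hxx, hzx, hxz]
    linear_combination 2 * ((z' 0 + z' 1) ^ 2 + (x' 0 + x' 1) ^ 2) * hA 0
      + 2 * ((z' 0 - z' 1) ^ 2 + (x' 0 - x' 1) ^ 2) * hA 1 + 4 * hB 0 + 4 * hB 1
      + 4 * (z 0 * z 1 + x 0 * x 1) * (hB 0 - hB 1)
  · obtain ⟨ZZ, eZZ⟩ : ∃ t, t = (M (0, 0) (0, 0)).re - (M (0, 1) (0, 1)).re
      - (M (1, 0) (1, 0)).re + (M (1, 1) (1, 1)).re := ⟨_, rfl⟩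
    obtain ⟨XX, eXX⟩ : ∃ t, t = (M (0, 0) (1, 1)).re + (M (1, 1) (0, 0)).re
      + (M (0, 1) (1, 0)).re + (M (1, 0) (0, 1)).re := ⟨_, rfl⟩
    obtain ⟨ZX, eZX⟩ : ∃ t, t = (M (0, 0) (0, 1)).re + (M (0, 1) (0, 0)).re
      - (M (1, 0) (1, 1)).re - (M (1, 1) (1, 0)).re := ⟨_, rfl⟩
    obtain ⟨XZ, eXZ⟩ : ∃ t, t = (M (0, 0) (1, 0)).re + (M (1, 0) (0, 0)).re
      - (M (0, 1) (1, 1)).re - (M (1, 1) (0, 1)).re := ⟨_, rfl⟩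
    have e1 : realForm M ![![c, s], ![-s, c]] - realForm M ![![-s, c], ![-c, -s]]
        = (c ^ 2 - s ^ 2) * ((ZZ + XX) / 2) + 2 * c * s * ((ZX - XZ) / 2) := by
      rw [eZZ, eXX, eZX, eXZ]
      simp [realForm, Fin.sum_univ_two]
      ring
    have e2 : realForm M ![![c', s'], ![s', -c']] - realForm M ![![s', -c'], ![-c', -s']]
        = (c' ^ 2 - s' ^ 2) * ((ZZ - XX) / 2) + 2 * c' * s' * ((ZX + XZ) / 2) := by
      rw [eZZ, eXX, eZX, eXZ]
      simp [realForm, Fin.sum_univ_two]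
      ring
    have e3 : T 0 0 + T 0 1 + T 1 0 - T 1 1 = mzz * ZZ + mxx * XX + mzx * ZX + mxz * XZ := by
      simp only [hT, trace_planar_kronecker, ← eZZ, ← eXX, ← eZX, ← eXZ, hzz, hxx, hzx, hxz]
      ring
    rw [e1, e2, e3]
    linear_combination (ZZ + XX) / 2 * hu + (ZX - XZ) / 2 * hv + (ZZ - XX) / 2 * hu'
      + (ZX + XZ) / 2 * hv'

theorem chsh_behaviour_le {ρ : Op} (hρ : IsState ρ) (A B : Fin 2 → QubitMeasurement) :
    chsh (behaviour ρ A B) ≤ (4 - 2 * √2) + (4 * √2 - 4) * fullyEntangledFraction ρ := by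
  obtain ⟨U, z, x, hzx, hA⟩ := exists_conj_planar fun i => (A i).isDichotomic_observable
  obtain ⟨V, z', x', hzx', hB⟩ := exists_conj_planar fun i => (B i).isDichotomic_observable
  set K : Op := (U : QubitOp) ⊗ₖ (V : QubitOp) with hK
  have hM : (Kᴴ * ρ * K).PosSemidef := hρ.1.conjTranspose_mul_mul_same K
  have ht : (Kᴴ * ρ * K).trace = 1 := by
    rw [Matrix.mul_assoc, trace_mul_comm, Matrix.mul_assoc, hK, kronecker_mul_conjTranspose_self,
      Matrix.mul_one, hρ.2]
  obtain ⟨a, b, c, s, c', s', ha, hb, hab, h, h', e⟩ :=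
    chsh_planar_eq (Kᴴ * ρ * K) z x z' x' hzx hzx' (corr (behaviour ρ A B)) fun i j => by
      rw [corr_behaviour, hA, hB, trace_conj_kronecker]
  have h2 : (-s) ^ 2 + c ^ 2 = 1 := by rw [← h]; ring
  have h2' : s' ^ 2 + (-c') ^ 2 = 1 := by rw [← h']; ring
  have hsum := overlap_sum_eq_trace (Kᴴ * ρ * K) c s c' s' h h'
  rw [← overlap_rot _ _ _ h, ← overlap_rot _ _ _ h2, ← overlap_refl _ _ _ h',
    ← overlap_refl _ _ _ h2'] at hsum e
  rw [ht, Complex.one_re] at hsum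
  have p1 := overlap_nonneg hM (rot _ _ h) 1
  have p2 := overlap_nonneg hM (rot _ _ h2) 1
  have p3 := overlap_nonneg hM (refl _ _ h') 1
  have p4 := overlap_nonneg hM (refl _ _ h2') 1
  -- The change of frame is absorbed into the unitaries over which F is a supremum.
  have q1 : overlap (Kᴴ * ρ * K) (rot _ _ h) 1 ≤ fullyEntangledFraction ρ := by
    rw [hK, overlap_conj]; exact overlap_le_fullyEntangledFraction hρ _ _
  have q3 : overlap (Kᴴ * ρ * K) (refl _ _ h') 1 ≤ fullyEntangledFraction ρ := by
    rw [hK, overlap_conj]; exact overlap_le_fullyEntangledFraction hρ _ _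
  have key := weighted_le_of_sq_add_sq ha hb hab p1 p3 (by linarith) q1 q3
  have := mul_nonneg ha p2
  have := mul_nonneg hb p4
  rw [chsh, e, mul_sub, mul_sub]
  linarith

/-! ### Existence of planar measurements and bounds on the supremum. -/

theorem exists_measurement (z x : ℝ) (h : z ^ 2 + x ^ 2 = 1) :
    ∃ m : QubitMeasurement, m.observable = planar z x := by
  have hc : (z : ℂ) ^ 2 + (x : ℂ) ^ 2 = 1 := by exact_mod_cast h
  have aux : ∀ z x : ℝ, z ^ 2 + x ^ 2 = 1 →
      (!![((1 + z) / 2 : ℂ), x / 2; x / 2, (1 - z) / 2] : QubitOp).rank = 1 := by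
    intro z x h
    have hc : (z : ℂ) ^ 2 + (x : ℂ) ^ 2 = 1 := by exact_mod_cast h
    set P : QubitOp := !![((1 + z) / 2 : ℂ), x / 2; x / 2, (1 - z) / 2] with hP
    -- Determinant 0 excludes rank two, and trace 1 excludes rank zero.
    have hdet : P.det = 0 := by
      rw [hP, det_fin_two_of]; linear_combination -hc / 4
    have hne : P.rank ≠ 0 := by
      intro h0
      have hz : P = 0 := by
        rw [Matrix.rank, Submodule.finrank_eq_zero, LinearMap.range_eq_bot] at h0
        exact ext_of_mulVec_single fun i =>
          (LinearMap.congr_fun h0 (Pi.single i 1)).trans (zero_mulVec _).symm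
      have := congrArg Matrix.trace hz
      rw [hP, trace_fin_two_of] at this
      simp at this
      have h1 : (1 : ℂ) = 0 := by linear_combination this
      exact one_ne_zero h1
    have hlt : P.rank ≤ 1 := by
      by_contra hlt
      have h2 : P.rank = 2 := le_antisymm (by simpa using P.rank_le_card_width) (by omega)
      have hu : LinearMap.range P.mulVecLin = ⊤ := by
        apply Submodule.eq_top_of_finrank_eq
        rw [← Matrix.rank, h2]; simp
      have hs : Function.Surjective P.mulVec := LinearMap.range_eq_top.1 hu
      have := (isUnit_iff_isUnit_det P).1 (mulVec_surjective_iff_isUnit.1 hs)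
      rw [hdet] at this
      exact not_isUnit_zero this
    omega
  refine ⟨⟨![!![((1 + z) / 2 : ℂ), x / 2; x / 2, (1 - z) / 2],
    !![((1 + (-z : ℝ)) / 2 : ℂ), (-x : ℝ) / 2; (-x : ℝ) / 2, (1 - (-z : ℝ)) / 2]], ?_, ?_, ?_, ?_⟩,
    ?_⟩
  · intro a
    ext i j
    fin_cases a <;> fin_cases i <;> fin_cases j <;> simp
  · intro a
    ext i j
    fin_cases a <;> fin_cases i <;> fin_cases j <;>
      simp [Matrix.mul_apply, Fin.sum_univ_two] <;>
      first | ring1 | linear_combination hc / 4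
  · intro a
    fin_cases a
    · exact aux z x h
    · exact aux (-z) (-x) (by rw [← h]; ring)
  · ext i j
    fin_cases i <;> fin_cases j <;> simp <;> ring
  · ext i j
    fin_cases i <;> fin_cases j <;> simp [QubitMeasurement.observable, planar] <;> ring

instance : Nonempty QubitMeasurement :=
  (exists_measurement 1 0 (by norm_num)).nonempty

theorem nonlocality_le {ρ : Op} (hρ : IsState ρ) :
    nonlocality ρ ≤ (4 - 2 * √2) + (4 * √2 - 4) * fullyEntangledFraction ρ :=
  ciSup_le fun AB => chsh_behaviour_le hρ AB.1 AB.2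

theorem chsh_le_nonlocality {ρ : Op} (hρ : IsState ρ) (A B : Fin 2 → QubitMeasurement) :
    chsh (behaviour ρ A B) ≤ nonlocality ρ :=
  le_ciSup (f := fun AB : (Fin 2 → QubitMeasurement) × (Fin 2 → QubitMeasurement) =>
    chsh (behaviour ρ AB.1 AB.2)) ⟨_, by rintro _ ⟨AB, rfl⟩; exact chsh_behaviour_le hρ _ _⟩ (A, B)

/-! ### The two estimates for Ω_α. -/

theorem weaklyEntangled_apply (α : ℝ) (i j k l : Fin 2) :
    weaklyEntangled α (i, j) (k, l) = if i = j ∧ k = l then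
      (if i = k then 1 / 2 else (α : ℂ) / 2) else 0 := by
  simp only [weaklyEntangled, ketbra, Matrix.add_apply, Matrix.smul_apply, vecMulVec_apply,
    Pi.star_apply, phiPlus_apply, ket_apply]
  fin_cases i <;> fin_cases j <;> fin_cases k <;> fin_cases l <;> simp [ofReal_inv_sqrt_two_mul_self] <;> ring

theorem ketbra_posSemidef (ψ : Fin 2 × Fin 2 → ℂ) : (ketbra ψ).PosSemidef :=
  posSemidef_vecMulVec_self_star ψ

theorem isState_weaklyEntangled {α : ℝ} (hα : α ∈ Set.Icc (0 : ℝ) 1) :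
    IsState (weaklyEntangled α) := by
  have h1 : (0 : ℂ) ≤ (α : ℂ) := by exact_mod_cast hα.1
  have h2 : (0 : ℂ) ≤ (((1 - α) / 2 : ℝ) : ℂ) := by
    exact_mod_cast div_nonneg (sub_nonneg.2 hα.2) zero_le_two
  refine ⟨(((ketbra_posSemidef _).smul h1).add ((ketbra_posSemidef _).smul h2)).add
    ((ketbra_posSemidef _).smul h2), ?_⟩
  simp [Matrix.trace, Fintype.sum_prod_type, weaklyEntangled_apply]

/-- The vector `(|00⟩ - |11⟩) / √2`. -/
noncomputable def phiMinus : Fin 2 × Fin 2 → ℂ :=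
  ((1 / Real.sqrt 2 : ℝ) : ℂ) • (ket 0 0 - ket 1 1)

/-- The largest eigenvalue of Ω_α is (1 + α)/2, at |Φ⁺⟩; the added term is the positive complement,
written in the eigenbasis. -/
theorem weaklyEntangled_add (α : ℝ) :
    weaklyEntangled α + ((α : ℂ) • ketbra phiMinus
      + (((1 + α) / 2 : ℝ) : ℂ) • (ketbra (ket 0 1) + ketbra (ket 1 0)))
      = (((1 + α) / 2 : ℝ) : ℂ) • 1 := by
  ext ⟨i, j⟩ ⟨k, l⟩
  simp only [ketbra, phiMinus, Matrix.add_apply, Matrix.smul_apply, vecMulVec_apply,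
    Pi.star_apply, Pi.smul_apply, Pi.sub_apply, weaklyEntangled_apply, ket_apply]
  fin_cases i <;> fin_cases j <;> fin_cases k <;> fin_cases l <;> simp [ofReal_inv_sqrt_two_mul_self] <;> ring

theorem fullyEntangledFraction_weaklyEntangled_le {α : ℝ} (hα : 0 ≤ α) :
    fullyEntangledFraction (weaklyEntangled α) ≤ (1 + α) / 2 := by
  refine ciSup_le fun UV => ?_
  have h := congrArg (fun M => overlap M UV.1 UV.2) (weaklyEntangled_add α)
  simp only [overlap_add, overlap_smul, overlap_one] at h
  have h1 := mul_nonneg hα (overlap_nonneg (ketbra_posSemidef phiMinus) UV.1 UV.2)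
  have h2 := mul_nonneg (show 0 ≤ (1 + α) / 2 by positivity)
    (add_nonneg (overlap_nonneg (ketbra_posSemidef (ket 0 1)) UV.1 UV.2)
      (overlap_nonneg (ketbra_posSemidef (ket 1 0)) UV.1 UV.2))
  linarith

theorem le_nonlocality_weaklyEntangled {α : ℝ} (hα : α ∈ Set.Icc (0 : ℝ) 1) :
    2 * √(1 + α ^ 2) ≤ nonlocality (weaklyEntangled α) := by
  set r := √(1 + α ^ 2) with hr
  have hr2 : r ^ 2 = 1 + α ^ 2 := Real.sq_sqrt (by positivity)
  have hr0 : 0 < r := Real.sqrt_pos.2 (by positivity)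
  obtain ⟨a₀, ha₀⟩ := exists_measurement 1 0 (by norm_num)
  obtain ⟨a₁, ha₁⟩ := exists_measurement 0 1 (by norm_num)
  -- Ω_α has ⟨σ_z ⊗ σ_z⟩ = 1 and ⟨σ_x ⊗ σ_x⟩ = α. With Alice measuring σ_z and σ_x, the value is 2/r
  -- + 2α²/r = 2r for Bob's directions (1, ±α)/r.
  obtain ⟨b₀, hb₀⟩ := exists_measurement (1 / r) (α / r) (by field_simp; linarith)
  obtain ⟨b₁, hb₁⟩ := exists_measurement (1 / r) (-α / r) (by field_simp; linarith)
  refine le_of_eq_of_le ?_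
    (chsh_le_nonlocality (isState_weaklyEntangled hα) ![a₀, a₁] ![b₀, b₁])
  simp only [chsh, corr_behaviour, Matrix.cons_val_zero, Matrix.cons_val_one, ha₀, ha₁, hb₀, hb₁,
    trace_planar_kronecker, weaklyEntangled_apply]
  simp
  field_simp
  linarith

end TwoQubit

theorem mainTheorem4 {ι κ : Type*} [Fintype ι] [Fintype κ]
    (α : ℝ) (hα : α ∈ Set.Icc (0 : ℝ) 1)
    (σ : ι → κ → TwoQubit.Op) (hσ : ∀ i j, TwoQubit.IsState (σ i j))
    (p : ι → κ → ℝ) (hp : ∀ i j, 0 ≤ p i j) (hp1 : ∑ i, ∑ j, p i j = 1)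
    (hF : ∑ i, ∑ j, p i j * TwoQubit.fullyEntangledFraction (σ i j)
      ≤ TwoQubit.fullyEntangledFraction (TwoQubit.weaklyEntangled α)) :
    ∑ i, ∑ j, p i j * TwoQubit.nonlocality (σ i j)
      ≤ TwoQubit.nonlocality (TwoQubit.weaklyEntangled α) + TwoQubit.gap α := by
  have hs1 : 1 ≤ √2 := Real.one_le_sqrt.2 one_le_two
  calc ∑ i, ∑ j, p i j * TwoQubit.nonlocality (σ i j)
      ≤ ∑ i, ∑ j, p i j * ((4 - 2 * √2)
          + (4 * √2 - 4) * TwoQubit.fullyEntangledFraction (σ i j)) :=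
        Finset.sum_le_sum fun i _ => Finset.sum_le_sum fun j _ =>
          mul_le_mul_of_nonneg_left (TwoQubit.nonlocality_le (hσ i j)) (hp i j)
    _ = (4 - 2 * √2) * (∑ i, ∑ j, p i j) + (4 * √2 - 4)
          * ∑ i, ∑ j, p i j * TwoQubit.fullyEntangledFraction (σ i j) := by
        simp only [Finset.mul_sum, ← Finset.sum_add_distrib]
        exact Finset.sum_congr rfl fun i _ => Finset.sum_congr rfl fun j _ => by ring
    _ ≤ (4 - 2 * √2) * 1 + (4 * √2 - 4) * ((1 + α) / 2) := by
        rw [hp1]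
        gcongr
        · linarith
        · exact hF.trans (TwoQubit.fullyEntangledFraction_weaklyEntangled_le hα.1)
    _ = 2 * √(1 + α ^ 2) + TwoQubit.gap α := by
        rw [TwoQubit.gap]; ring
    _ ≤ _ := by
        gcongr
        exact TwoQubit.le_nonlocality_weaklyEntangled hα
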